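/- Let $\Sigma$ be a set of visible letters, $\tau\notin\Sigma$ a silent letter, $\Sigma_\tau=\Sigma\cup\{\tau\}$. **Systems.** For a set $X$ let $\mathcal M X$ be the $[0,\infty)$-semimodule of finitely supported maps $X\to[0,\infty)$ (with $\mathcal Mf$ the push-forward along $f$), $\mathcal D_{fin}X\subseteq\mathcal MX$ the set of those of total mass $1$, and $\mathcal{CM}X$ the set of non-empty convex subsets of $\mathcal MX$, with $\mathcal{CM}f(U)=\mathcal Mf(U)$. A finitary simple Segala system is a map $\alpha:X\to\mathcal P(\Sigma_\tau\times\mathcal D_{fin}X)$; write $x\xrightarrow{\sigma}\mu$ for $(\sigma,\mu)\in\alpha(x)$. Its associated $\mathcal{CM}(\Sigma_\tau\times\mathcal Id)$-coalgebra $\underline\alpha:X\to\mathcal{CM}(\Sigma_\tau\times X)$ sends $x$ to the convex closure of $\{0\}\cup\{\sum_{x'}\mu(x')\cdot(\sigma,x')\mid x\xrightarrow{\sigma}\mu\}$. **Probabilistic weak bisimulation.** A step from $x$ is a measure $\sum_{x'}\mu(x')\cdot(\sigma,x')$ with $x\xrightarrow{\sigma}\mu$. A finite combined step from $x$ with deadlock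 probability $p_0$ is $\nu=\sum_{i=1}^k p_i\cdot\nu_i$, where $k\ge 0$, the $\nu_i$ are steps from $x$, $p_0,\dots,p_k\ge 0$ and $p_0+\dots+p_k=1$. Relations $\overset{\sigma}{\leadsto}_n\subseteq X\times\mathcal D_{fin}X$ are defined by: $\overset{\tau}{\leadsto}_0=\{(x,\delta_x)\mid x\in X\}$ and $\overset{\sigma}{\leadsto}_0=\varnothing$ for $\sigma\ne\tau$; and $x\overset{\sigma}{\leadsto}_{n+1}\mu$ iff there is a finite combined step $\nu$ from $x$ with deadlock probability $p_0$, where $p_0=0$ unless $\sigma=\tau$, such that $\nu$ vanishes outside $\{\sigma,\tau\}\times X$ and $$\mu=p_0\cdot\delta_x+\sum_{(\sigma',x')\in\mathrm{supp}\,\nu}\nu(\sigma',x')\cdot\mu_{(\sigma',x')}$$ for some $\mu_{(\sigma',x')}$ with $x'\overset{\tau}{\leadsto}_n\mu_{(\sigma',x')}$ if $\sigma'=\sigma$, and $x'\overset{\sigma}{\leadsto}_n\mu_{(\sigma',x')}$ otherwise. Put $x\overset{\sigma}{\leadsto}\mu$ iff $x\overset{\sigma}{\leadsto}_n\mu$ for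 some $n$. An equivalence relation $R$ on $X$ is a *probabilistic weak bisimulation* on $\alpha$ if $(x,y)\in R$ and $x\xrightarrow{\sigma}\mu$ imply that there is $\mu'$ with $y\overset{\sigma}{\leadsto}\mu'$ such that $\mu$ and $\mu'$ are the two marginals of some element of $\mathcal D_{fin}R$. **Coalgebraic weak bisimulation.** In the Kleisli category of the monad $\mathcal{CM}$ the composite of $f:X\to\mathcal{CM}Y$ and $g:Y\to\mathcal{CM}Z$ is $(g\cdot f)(x)=\bigcup_{\varphi\in f(x)}\{\sum_{y}\varphi(y)\psi_y\mid \psi_y\in g(y)\}$. Put $T=\mathcal{CM}(\Sigma_\tau\times\mathcal Id)$. The composite of $f:X\to TY$ and $g:Y\to TZ$ in the Kleisli category of the monad $T$ is $g\bullet f=m_Z\cdot\overline{\Sigma_\tau}g\cdot f$, with identities $e_X(x)=\{1\cdot(\tau,x)\}$, where $\overline{\Sigma_\tau}g(\sigma,y)=\{\sum_q\psi(q)\cdot(\sigma,q)\mid\psi\in g(y)\}$, $m(\sigma,\tau,z)=\{1\cdot(\sigma,z)\}$, $m(\tau,\sigma,z)=\{1\cdot(\sigma,z)\}$ and $m(\sigma_1,\sigma_2,z)=\{0\}$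 for $\sigma_1,\sigma_2\ne\tau$. Maps into $TX$ are ordered by pointwise inclusion, and for $\beta:X\to TX$ the saturation $\beta^*$ is the least $\theta:X\to TX$ with $e_X\le\theta$, $\beta\le\theta$ and $\theta\bullet\theta\le\theta$. A symmetric relation $R\subseteq X\times X$ with projections $\pi_1,\pi_2:R\to X$ is a *weak bisimulation* on $\beta:X\to TX$ if there is $\gamma:R\to TR$ with $\beta\circ\pi_1\le T\pi_1\circ\gamma$ and $T\pi_2\circ\gamma\le\beta^*\circ\pi_2$. **Theorem.** Let $\alpha$ be a finitary simple Segala system with state space $X$ and let $R$ be an equivalence relation on $X$. Then $R$ is a probabilistic weak bisimulation on $\alpha$ if and only if $R$ is a weak bisimulation on the associated coalgebra $\underline\alpha$. -/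

import Mathlib

open scoped NNReal

noncomputable section

namespace SegalaWeak

universe u v w

/-! ### The functor `M` of finitely supported `[0,∞)`-valued maps is `X ↦ (X →₀ ℝ≥0)`,
acting on maps by `Finsupp.mapDomain`. -/

/-- `CM X`: the non-empty convex subsets of the free `[0,∞)`-semimodule over `X`. -/
@[ext]
structure CM (X : Type u) where
  carrier : Set (X →₀ ℝ≥0)
  nonempty : carrier.Nonempty
  convex : Convex ℝ≥0 carrier

namespace CM

instance {X : Type u} : Membership (X →₀ ℝ≥0) (CM X) := ⟨fun U φ => φ ∈ U.carrier⟩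

/-- `CM X` is ordered by inclusion; families of elements are ordered pointwise. -/
instance {X : Type u} : PartialOrder (CM X) :=
  PartialOrder.lift CM.carrier fun _ _ h => CM.ext h

/-- The singleton `{φ}`. -/
def pure {X : Type u} (φ : X →₀ ℝ≥0) : CM X where
  carrier := {φ}
  nonempty := Set.singleton_nonempty φ
  convex := convex_singleton φ

/-- The action of the functor `CM` on maps: the direct image under `M f`. -/
def map {X : Type u} {Y : Type v} (f : X → Y) (U : CM X) : CM Y where
  carrier := Finsupp.mapDomain f '' U.carrier
  nonempty := U.nonempty.image _
  convex := by
    rintro _ ⟨φ, hφ, rfl⟩ _ ⟨ψ, hψ, rfl⟩ a b ha hb hab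
    refine ⟨a • φ + b • ψ, U.convex hφ hψ ha hb hab, ?_⟩
    rw [Finsupp.mapDomain_add, Finsupp.mapDomain_smul, Finsupp.mapDomain_smul]

/-- The unit of the monad `CM`. -/
def unit {X : Type u} (x : X) : CM X := pure (Finsupp.single x 1)

/-- The underlying set of the Kleisli composite `g · f` at `x`:
the union over `φ ∈ f x` of the sets `∑_{y ∈ supp φ} φ(y) · g(y)`.
(Each `g y` is non-empty, so choosing `ψ y ∈ g y` outside the support is harmless.) -/
def compSet {X : Type u} {Y : Type v} {Z : Type w} (g : Y → CM Z) (f : X → CM Y) (x : X) :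
    Set (Z →₀ ℝ≥0) :=
  {χ | ∃ φ ∈ f x, ∃ ψ : Y → (Z →₀ ℝ≥0), (∀ y, ψ y ∈ g y) ∧ χ = φ.sum fun y r => r • ψ y}

theorem compSet_nonempty {X : Type u} {Y : Type v} {Z : Type w} (g : Y → CM Z) (f : X → CM Y)
    (x : X) : (compSet g f x).Nonempty := by
  obtain ⟨φ, hφ⟩ := (f x).nonempty
  exact ⟨_, φ, hφ, fun y => (g y).nonempty.some, fun y => (g y).nonempty.some_mem, rfl⟩

theorem compSet_convex {X : Type u} {Y : Type v} {Z : Type w} (g : Y → CM Z) (f : X → CM Y)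
    (x : X) : Convex ℝ≥0 (compSet g f x) := by
  classical
  rintro _ ⟨φ₁, hφ₁, ψ₁, hψ₁, rfl⟩ _ ⟨φ₂, hφ₂, ψ₂, hψ₂, rfl⟩ a b ha hb hab
  have key : ∀ y, ∃ θ ∈ g y,
      (a * φ₁ y + b * φ₂ y) • θ = (a * φ₁ y) • ψ₁ y + (b * φ₂ y) • ψ₂ y := by
    intro y
    by_cases h : a * φ₁ y + b * φ₂ y = 0
    · have h1 : a * φ₁ y = 0 := (add_eq_zero.mp h).1
      have h2 : b * φ₂ y = 0 := (add_eq_zero.mp h).2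
      exact ⟨ψ₁ y, hψ₁ y, by simp [h1, h2]⟩
    · refine ⟨(a * φ₁ y / (a * φ₁ y + b * φ₂ y)) • ψ₁ y
          + (b * φ₂ y / (a * φ₁ y + b * φ₂ y)) • ψ₂ y,
        (g y).convex (hψ₁ y) (hψ₂ y) zero_le zero_le ?_, ?_⟩
      · rw [← add_div, div_self h]
      · rw [smul_add, smul_smul, smul_smul, mul_div_cancel₀ _ h, mul_div_cancel₀ _ h]
  choose θ hθ hθ' using key
  refine ⟨a • φ₁ + b • φ₂, (f x).convex hφ₁ hφ₂ ha hb hab, θ, hθ, ?_⟩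
  set s := φ₁.support ∪ φ₂.support with hs
  have e1 : (φ₁.sum fun y r => r • ψ₁ y) = ∑ y ∈ s, φ₁ y • ψ₁ y :=
    Finsupp.sum_of_support_subset _ Finset.subset_union_left _ (by simp)
  have e2 : (φ₂.sum fun y r => r • ψ₂ y) = ∑ y ∈ s, φ₂ y • ψ₂ y :=
    Finsupp.sum_of_support_subset _ Finset.subset_union_right _ (by simp)
  have e3 : ((a • φ₁ + b • φ₂).sum fun y r => r • θ y)
      = ∑ y ∈ s, (a • φ₁ + b • φ₂) y • θ y := by
    refine Finsupp.sum_of_support_subset _ ?_ _ (by simp)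
    exact Finsupp.support_add.trans
      (Finset.union_subset_union Finsupp.support_smul Finsupp.support_smul)
  rw [e1, e2, e3, Finset.smul_sum, Finset.smul_sum, ← Finset.sum_add_distrib]
  refine Finset.sum_congr rfl fun y _ => ?_
  simp only [Finsupp.add_apply, Finsupp.smul_apply, smul_eq_mul, smul_smul]
  exact (hθ' y).symm

/-- Kleisli composition `g · f` for the monad `CM`. -/
def comp {X : Type u} {Y : Type v} {Z : Type w} (g : Y → CM Z) (f : X → CM Y) : X → CM Z :=
  fun x => ⟨compSet g f x, compSet_nonempty g f x, compSet_convex g f x⟩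

theorem comp_mono {X : Type u} {Y : Type v} {Z : Type w} {g g' : Y → CM Z} {f f' : X → CM Y}
    (hg : g ≤ g') (hf : f ≤ f') : comp g f ≤ comp g' f' := by
  rintro x _ ⟨φ, hφ, ψ, hψ, rfl⟩
  exact ⟨φ, hf x hφ, ψ, fun y => hg y (hψ y), rfl⟩

end CM

/-! ### Labels and the monad `CM(Σ_τ × Id)` -/

/-- `Σ_τ`: the alphabet `A` with the additional silent letter `τ`. -/
abbrev Label (A : Type u) : Type u := Option A

/-- The silent letter. -/
abbrev tau {A : Type u} : Label A := none

variable {A : Type u}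

/-- The formal sum `∑ₓ φ(x) · (σ, x)`. -/
def tag {X : Type v} (σ : Label A) (φ : X →₀ ℝ≥0) : (Label A × X) →₀ ℝ≥0 :=
  φ.mapDomain fun x => (σ, x)

/-- The lifting of the functor `Σ_τ × Id` to the Kleisli category of `CM`, given by strength. -/
def lift {X : Type v} {Y : Type w} (f : X → CM Y) : Label A × X → CM (Label A × Y) :=
  fun p => CM.map (fun y => (p.1, y)) (f p.2)

/-- The multiplication of the lifted functor: it absorbs silent letters and sends two
consecutive visible letters to zero. -/
def mult {X : Type v} : Label A × (Label A × X) → CM (Label A × X)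
  | (σ, (none, x)) => CM.unit (σ, x)
  | (none, (some a, x)) => CM.unit (some a, x)
  | (some _, (some _, _)) => CM.pure 0

/-- The unit of the lifted functor; it is the Kleisli identity of `CM(Σ_τ × Id)`. -/
def ident {X : Type v} : X → CM (Label A × X) := fun x => CM.unit (tau, x)

/-- Kleisli composition of the monad `CM(Σ_τ × Id)`. -/
def kcomp {X Y Z : Type*} (g : Y → CM (Label A × Z)) (f : X → CM (Label A × Y)) :
    X → CM (Label A × Z) :=
  CM.comp mult (CM.comp (lift g) f)

/-- The action of the functor `CM(Σ_τ × Id)` on maps. -/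
def tmap {X Y : Type*} (f : X → Y) : CM (Label A × X) → CM (Label A × Y) :=
  CM.map (Prod.map id f)

theorem kcomp_mono {X Y Z : Type*} {g g' : Y → CM (Label A × Z)} {f f' : X → CM (Label A × Y)}
    (hg : g ≤ g') (hf : f ≤ f') : kcomp g f ≤ kcomp g' f' := by
  refine CM.comp_mono le_rfl (CM.comp_mono ?_ hf)
  rintro p _ ⟨φ, hφ, rfl⟩
  exact ⟨φ, hg p.2 hφ, rfl⟩

/-! ### Saturation and coalgebraic weak bisimulation -/

/-- The coalgebras above `α` that are reflexive and transitive for Kleisli composition. -/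
def saturatedAbove {X : Type v} (α : X → CM (Label A × X)) : Set (X → CM (Label A × X)) :=
  {β | ident ≤ β ∧ α ≤ β ∧ kcomp β β ≤ β}

/-- The saturation of `α`, see `saturation_isLeast`. -/
def saturation {X : Type v} (α : X → CM (Label A × X)) (x : X) : CM (Label A × X) where
  carrier := ⋂ β ∈ saturatedAbove α, (β x).carrier
  nonempty := ⟨Finsupp.single (tau, x) 1, Set.mem_iInter₂.mpr fun _ hβ => hβ.1 x rfl⟩
  convex := convex_iInter₂ fun β _ => (β x).convex

/-- The saturation is the least `β` with `1 ≤ β`, `α ≤ β` and `β · β ≤ β`. -/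
theorem saturation_isLeast {X : Type v} (α : X → CM (Label A × X)) :
    IsLeast (saturatedAbove α) (saturation α) := by
  have hlb : ∀ β ∈ saturatedAbove α, saturation α ≤ β := fun β hβ x φ hφ =>
    Set.mem_iInter₂.mp hφ β hβ
  refine ⟨⟨?_, ?_, ?_⟩, hlb⟩
  · exact fun x φ hφ => Set.mem_iInter₂.mpr fun β hβ => hβ.1 x hφ
  · exact fun x φ hφ => Set.mem_iInter₂.mpr fun β hβ => hβ.2.1 x hφ
  · exact fun x φ hφ => Set.mem_iInter₂.mpr fun β hβ =>
      hβ.2.2 x (kcomp_mono (hlb β hβ) (hlb β hβ) x hφ)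

/-- The set of pairs of a relation, as a state space. -/
abbrev Graph {X : Type v} (R : X → X → Prop) : Type v := {p : X × X // R p.1 p.2}

/-- The first projection. -/
abbrev fst {X : Type v} {R : X → X → Prop} (p : Graph R) : X := p.1.1

/-- The second projection. -/
abbrev snd {X : Type v} {R : X → X → Prop} (p : Graph R) : X := p.1.2

/-- Coalgebraic weak bisimulation: a symmetric relation `R` carrying a coalgebra structure `γ`
with `α ∘ π₁ ≤ T π₁ ∘ γ` and `T π₂ ∘ γ ≤ α* ∘ π₂`, where `T = CM(Σ_τ × Id)`. -/
def IsCoalgWeakBisim {X : Type v} (α : X → CM (Label A × X)) (R : X → X → Prop) : Prop :=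
  (∀ x y, R x y → R y x) ∧
    ∃ γ : Graph R → CM (Label A × Graph R),
      α ∘ fst ≤ tmap fst ∘ γ ∧ tmap snd ∘ γ ≤ saturation α ∘ snd

/-! ### Finitary simple Segala systems -/

/-- Finitely supported probability measures. -/
@[ext]
structure FinDist (X : Type v) where
  wt : X →₀ ℝ≥0
  total : (wt.sum fun _ r => r) = 1

namespace FinDist

/-- The point mass at `x`. -/
def dirac {X : Type v} (x : X) : FinDist X where
  wt := Finsupp.single x 1
  total := by simp

/-- The image measure. -/
def map {X : Type v} {Y : Type w} (f : X → Y) (μ : FinDist X) : FinDist Y where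
  wt := μ.wt.mapDomain f
  total := by
    rw [Finsupp.sum_mapDomain_index (fun _ => rfl) (fun _ _ _ => rfl)]
    exact μ.total

end FinDist

/-- A finitary simple Segala system; `(σ, μ) ∈ α x` is the strong arrow `x →σ μ`. -/
abbrev SimpleSegala (A : Type u) (X : Type v) := X → Set (Label A × FinDist X)

/-- The associated `CM(Σ_τ × Id)`-coalgebra: the convex closure of `{0} ∪ α x`. -/
def SimpleSegala.toCoalg {X : Type v} (α : SimpleSegala A X) (x : X) : CM (Label A × X) where
  carrier := convexHull ℝ≥0 ({0} ∪ {ν | ∃ σ μ, (σ, μ) ∈ α x ∧ ν = tag σ μ.wt})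
  nonempty := ⟨0, subset_convexHull _ _ (Or.inl rfl)⟩
  convex := convex_convexHull _ _

/-- A step `(x, ν)`: `ν` is a measure `μ` with `x →σ μ`, placed on the letter `σ`. -/
def IsStep {X : Type v} (α : SimpleSegala A X) (x : X) (ν : (Label A × X) →₀ ℝ≥0) : Prop :=
  ∃ σ μ, (σ, μ) ∈ α x ∧ ν = tag σ μ.wt

/-- A finite combined step from `x`: with probability `p₀` no step is taken (deadlock), and
otherwise one of finitely many steps is taken, so that `ν = ∑ᵢ pᵢ · νᵢ` and `p₀ + ∑ᵢ pᵢ = 1`. -/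
def IsCombinedStep {X : Type v} (α : SimpleSegala A X) (x : X) (p₀ : ℝ≥0)
    (ν : (Label A × X) →₀ ℝ≥0) : Prop :=
  ∃ (k : ℕ) (p : Fin k → ℝ≥0) (ν' : Fin k → ((Label A × X) →₀ ℝ≥0)),
    p₀ + ∑ i, p i = 1 ∧ (∀ i, IsStep α x (ν' i)) ∧ ν = ∑ i, p i • ν' i

/-- The weak arrow of depth at most `n`. A deadlock of positive probability is allowed only if no
visible letter remains to be performed; its mass then stays at the current state. -/
def WeakArrowN {X : Type v} (α : SimpleSegala A X) : ℕ → Label A → X → FinDist X → Prop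
  | 0, σ, x, μ => σ = tau ∧ μ = FinDist.dirac x
  | n + 1, σ, x, μ =>
    ∃ (p₀ : ℝ≥0) (ν : (Label A × X) →₀ ℝ≥0) (κ : Label A × X → FinDist X),
      IsCombinedStep α x p₀ ν ∧
      (p₀ ≠ 0 → σ = tau) ∧
      (∀ q, q.1 ≠ σ → q.1 ≠ tau → ν q = 0) ∧
      (∀ q ∈ ν.support,
        (q.1 = σ → WeakArrowN α n tau q.2 (κ q)) ∧
        (q.1 ≠ σ → WeakArrowN α n σ q.2 (κ q))) ∧
      μ.wt = p₀ • Finsupp.single x 1 + ν.sum fun q r => r • (κ q).wt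

/-- The weak arrow `x ⇝σ μ`. -/
def WeakArrow {X : Type v} (α : SimpleSegala A X) (σ : Label A) (x : X) (μ : FinDist X) : Prop :=
  ∃ n, WeakArrowN α n σ x μ

/-- The relation between measures induced by `R`: being the two marginals of a measure on `R`. -/
def LiftRel {X : Type v} (R : X → X → Prop) (μ μ' : FinDist X) : Prop :=
  ∃ ρ : FinDist (Graph R), ρ.map fst = μ ∧ ρ.map snd = μ'

/-- Probabilistic weak bisimulation. -/
def IsProbWeakBisim {X : Type v} (α : SimpleSegala A X) (R : X → X → Prop) : Prop :=
  Equivalence R ∧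
    ∀ x y, R x y → ∀ σ μ, (σ, μ) ∈ α x → ∃ μ', WeakArrow α σ y μ' ∧ LiftRel R μ μ'

end SegalaWeak

end

noncomputable section

namespace SegalaWeak

open Finsupp (linearCombination)

/-! ### Total mass -/

/-! Both notions are compared through one equivalence: `tag σ μ.wt` lies in the saturation at `x`
iff `WeakArrow α σ x μ`. From right to left (`WeakArrowN.tag_mem`), induction on the depth rebuilds
an arrow inside any reflexive, transitive coalgebra above `α.toCoalg`: identities supply the
deadlock, Kleisli composition the continuation, convexity the mixture.

From left to right, the saturation also contains measures of mass below one and measures mixing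
several letters, so it is not described explicitly. It is bounded by `weakCoalg`, a testing
condition: every completion of the measure to a probability measure is a weak arrow. Measures of
smaller mass satisfy it vacuously. It is convex because weak arrows are (`WeakArrow.mix`). It is
transitive (`kcomp_weakCoalg_le`) because a composite of mass one has lost no mass, so no two
visible letters met and completions can be performed in two stages.

Given the equivalence, a measure on `R` with marginals `μ`, `μ'` and a measure in `γ` over `tag σ
μ.wt` are the same data, since projecting from `R` leaves letters unchanged
(`eq_tag_of_mapDomain_eq_tag`). -/

/-- The total mass of a finitely supported measure. -/
def mass {X : Type*} : (X →₀ ℝ≥0) →ₗ[ℝ≥0] ℝ≥0 := linearCombination ℝ≥0 fun _ => 1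

theorem mass_eq_sum {X : Type*} (φ : X →₀ ℝ≥0) : mass φ = φ.sum fun _ r => r := by
  simp [mass, Finsupp.linearCombination_apply]

@[simp]
theorem mass_single {X : Type*} (x : X) (r : ℝ≥0) : mass (Finsupp.single x r) = r := by
  simp [mass]

@[simp]
theorem mass_mapDomain {X Y : Type*} (f : X → Y) (φ : X →₀ ℝ≥0) :
    mass (φ.mapDomain f) = mass φ := by
  simp only [mass, Finsupp.linearCombination_mapDomain]
  rfl

@[simp]
theorem FinDist.mass_wt {X : Type*} (μ : FinDist X) : mass μ.wt = 1 :=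
  (mass_eq_sum _).trans μ.total

theorem exists_finDist {X : Type*} {φ : X →₀ ℝ≥0} (h : mass φ = 1) :
    ∃ μ : FinDist X, μ.wt = φ :=
  ⟨⟨φ, (mass_eq_sum φ).symm.trans h⟩, rfl⟩

theorem map_linearCombination {X M N : Type*} [AddCommMonoid M] [Module ℝ≥0 M]
    [AddCommMonoid N] [Module ℝ≥0 N] (f : M →ₗ[ℝ≥0] N) (v : X → M) (φ : X →₀ ℝ≥0) :
    f (linearCombination ℝ≥0 v φ) = linearCombination ℝ≥0 (fun x => f (v x)) φ := by
  simp [Finsupp.linearCombination_apply, map_finsuppSum]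

theorem linearCombination_congr {X M : Type*} [AddCommMonoid M] [Module ℝ≥0 M]
    {v w : X → M} {φ : X →₀ ℝ≥0} (h : ∀ x ∈ φ.support, v x = w x) :
    linearCombination ℝ≥0 v φ = linearCombination ℝ≥0 w φ := by
  simp only [Finsupp.linearCombination_apply]
  exact Finsupp.sum_congr fun x hx => by rw [h x hx]

theorem mass_linearCombination {X Y : Type*} {v : X → (Y →₀ ℝ≥0)} {φ : X →₀ ℝ≥0}
    (h : ∀ x ∈ φ.support, mass (v x) = 1) : mass (linearCombination ℝ≥0 v φ) = mass φ := by
  rw [map_linearCombination]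
  exact linearCombination_congr h

theorem linearCombination_le_one {X : Type*} {v : X → ℝ≥0} {φ : X →₀ ℝ≥0}
    (hv : ∀ x, v x ≤ 1) (hφ : mass φ ≤ 1) : linearCombination ℝ≥0 v φ ≤ 1 := by
  refine le_trans ?_ hφ
  simp only [mass, Finsupp.linearCombination_apply, Finsupp.sum, smul_eq_mul]
  exact Finset.sum_le_sum fun x _ => by gcongr; exact hv x

/-- The equality case of the preceding bound. It turns "the composite has mass one" into "no mass
was lost at any stage". -/
theorem eq_one_of_linearCombination_eq_one {X : Type*} {v : X → ℝ≥0} {φ : X →₀ ℝ≥0}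
    (hv : ∀ x, v x ≤ 1) (hφ : mass φ ≤ 1) (h : linearCombination ℝ≥0 v φ = 1) :
    mass φ = 1 ∧ ∀ x ∈ φ.support, v x = 1 := by
  have hle : ∀ x ∈ φ.support, φ x * v x ≤ φ x * 1 := fun x _ => by gcongr; exact hv x
  have e1 : linearCombination ℝ≥0 v φ = ∑ x ∈ φ.support, φ x * v x := by
    simp [Finsupp.linearCombination_apply, Finsupp.sum]
  have e2 : mass φ = ∑ x ∈ φ.support, φ x * 1 := by
    simp [mass, Finsupp.linearCombination_apply, Finsupp.sum]
  have h1 : mass φ = 1 := by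
    refine le_antisymm hφ ?_
    rw [← h, e1, e2]
    exact Finset.sum_le_sum hle
  refine ⟨h1, fun x hx => ?_⟩
  have := (Finset.sum_eq_sum_iff_of_le hle).mp (by rw [← e1, ← e2, h, h1]) x hx
  exact mul_left_cancel₀ (Finsupp.mem_support_iff.mp hx) this

/-- Nonnegative weights cannot cancel. -/
theorem mem_support_linearCombination {X Y : Type*} {v : X → (Y →₀ ℝ≥0)} {φ : X →₀ ℝ≥0}
    {x : X} {y : Y} (hx : x ∈ φ.support) (hy : y ∈ (v x).support) :
    y ∈ (linearCombination ℝ≥0 v φ).support := by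
  rw [Finsupp.mem_support_iff] at hy ⊢
  simp only [Finsupp.linearCombination_apply, Finsupp.sum, Finsupp.finsetSum_apply]
  intro h
  have := (Finset.sum_eq_zero_iff.mp h) x hx
  simp only [Finsupp.smul_apply, smul_eq_mul, mul_eq_zero] at this
  exact this.elim (Finsupp.mem_support_iff.mp hx) hy

theorem mem_support_mapDomain {X Y : Type*} {f : X → Y} {φ : X →₀ ℝ≥0} {x : X}
    (hx : x ∈ φ.support) : f x ∈ (φ.mapDomain f).support := by
  have : φ.mapDomain f = linearCombination ℝ≥0 (fun x => Finsupp.single (f x) 1) φ := by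
    simp [Finsupp.linearCombination_apply, Finsupp.mapDomain]
  rw [this]
  exact mem_support_linearCombination hx (by simp)

/-- Serves the moving part of a combined step, whose weights sum to `1 - p₀` and must be
renormalised before convexity applies. -/
theorem convex_inv_smul_sum_mem {I X : Type*} {S : Set (X →₀ ℝ≥0)} (hS : Convex ℝ≥0 S)
    {s : Finset I} {p : I → ℝ≥0} {θ : I → (X →₀ ℝ≥0)} (hθ : ∀ i ∈ s, θ i ∈ S)
    (hp : ∑ i ∈ s, p i ≠ 0) : (∑ i ∈ s, p i)⁻¹ • ∑ i ∈ s, p i • θ i ∈ S := by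
  classical
  induction s using Finset.induction_on with
  | empty => simp at hp
  | insert i s hi ih =>
    rw [Finset.sum_insert hi] at hp
    rw [Finset.sum_insert hi, Finset.sum_insert hi]
    by_cases h0 : ∑ j ∈ s, p j = 0
    · have hz : ∑ j ∈ s, p j • θ j = 0 := Finset.sum_eq_zero fun j hj => by
        rw [Finset.sum_eq_zero_iff.mp h0 j hj, zero_smul]
      rw [h0, add_zero] at hp ⊢
      rw [hz, add_zero, smul_smul, inv_mul_cancel₀ hp, one_smul]
      exact hθ i (Finset.mem_insert_self _ _)
    · have hmem := hS (hθ i (Finset.mem_insert_self _ _))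
        (ih (fun j hj => hθ j (Finset.mem_insert_of_mem hj)) h0)
        (a := (p i + ∑ j ∈ s, p j)⁻¹ * p i) (b := (p i + ∑ j ∈ s, p j)⁻¹ * ∑ j ∈ s, p j)
        zero_le zero_le (by rw [← mul_add, inv_mul_cancel₀ hp])
      rwa [mul_smul, mul_smul, smul_smul (∑ j ∈ s, p j), mul_inv_cancel₀ h0, one_smul,
        ← smul_add] at hmem

theorem exists_finDist_mix {X : Type*} (μ₁ μ₂ : FinDist X) {a b : ℝ≥0} (hab : a + b = 1) :
    ∃ μ : FinDist X, μ.wt = a • μ₁.wt + b • μ₂.wt :=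
  exists_finDist (by simp [hab])

/-- Mixing two families of measures along a mixture of the weights. -/
theorem exists_mix_family {I X : Type*} {P : I → FinDist X → Prop}
    (hP : ∀ i (μ₁ μ₂ μ : FinDist X) (a b : ℝ≥0), a + b = 1 → P i μ₁ → P i μ₂ →
      μ.wt = a • μ₁.wt + b • μ₂.wt → P i μ)
    {ν₁ ν₂ : I →₀ ℝ≥0} {κ₁ κ₂ : I → FinDist X} (a b : ℝ≥0)
    (h₁ : ∀ i ∈ ν₁.support, P i (κ₁ i)) (h₂ : ∀ i ∈ ν₂.support, P i (κ₂ i)) :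
    ∃ κ : I → FinDist X, (∀ i ∈ (a • ν₁ + b • ν₂).support, P i (κ i)) ∧
      linearCombination ℝ≥0 (fun i => (κ i).wt) (a • ν₁ + b • ν₂) =
        a • linearCombination ℝ≥0 (fun i => (κ₁ i).wt) ν₁ +
        b • linearCombination ℝ≥0 (fun i => (κ₂ i).wt) ν₂ := by
  classical
  -- At `i` the two measures are averaged in the ratio `a * ν₁ i : b * ν₂ i`. If one weight
  -- vanishes, its `P i` may be unavailable, and the other measure is taken unchanged.
  have key : ∀ i, ∃ μ : FinDist X, (i ∈ (a • ν₁ + b • ν₂).support → P i μ) ∧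
      (a * ν₁ i + b * ν₂ i) • μ.wt = (a * ν₁ i) • (κ₁ i).wt + (b * ν₂ i) • (κ₂ i).wt := by
    intro i
    by_cases e₁ : a * ν₁ i = 0
    · refine ⟨κ₂ i, fun hi => h₂ i ?_, by simp [e₁]⟩
      simp only [Finsupp.mem_support_iff, Finsupp.add_apply, Finsupp.smul_apply, smul_eq_mul,
        e₁, zero_add] at hi ⊢
      exact right_ne_zero_of_mul hi
    by_cases e₂ : b * ν₂ i = 0
    · exact ⟨κ₁ i, fun _ => h₁ i (Finsupp.mem_support_iff.mpr (right_ne_zero_of_mul e₁)),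
        by simp [e₂]⟩
    have hs : a * ν₁ i + b * ν₂ i ≠ 0 := fun h => e₁ (add_eq_zero.mp h).1
    have hab : a * ν₁ i / (a * ν₁ i + b * ν₂ i) + b * ν₂ i / (a * ν₁ i + b * ν₂ i) = 1 := by
      rw [← add_div, div_self hs]
    obtain ⟨μ, hμ⟩ := exists_finDist_mix (κ₁ i) (κ₂ i) hab
    refine ⟨μ, fun _ => hP i _ _ μ _ _ hab
      (h₁ i (Finsupp.mem_support_iff.mpr (right_ne_zero_of_mul e₁)))
      (h₂ i (Finsupp.mem_support_iff.mpr (right_ne_zero_of_mul e₂))) hμ, ?_⟩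
    rw [hμ, smul_add, smul_smul, smul_smul, mul_div_cancel₀ _ hs, mul_div_cancel₀ _ hs]
  choose κ hκ hκ' using key
  refine ⟨κ, hκ, ?_⟩
  have e (ν : I →₀ ℝ≥0) (κ : I → FinDist X) (hν : ν.support ⊆ ν₁.support ∪ ν₂.support) :
      linearCombination ℝ≥0 (fun i => (κ i).wt) ν =
        ∑ i ∈ ν₁.support ∪ ν₂.support, ν i • (κ i).wt := by
    rw [Finsupp.linearCombination_apply]
    exact Finsupp.sum_of_support_subset _ hν _ (by simp)
  rw [e _ κ, e ν₁ κ₁ Finset.subset_union_left, e ν₂ κ₂ Finset.subset_union_right,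
    Finset.smul_sum, Finset.smul_sum, ← Finset.sum_add_distrib]
  · refine Finset.sum_congr rfl fun i _ => ?_
    simpa [smul_smul] using hκ' i
  · exact Finsupp.support_add.trans
      (Finset.union_subset_union Finsupp.support_smul Finsupp.support_smul)

/-! ### Weak arrows -/

section WeakArrow

variable {A X : Type*} {α : SimpleSegala A X}

theorem IsCombinedStep.mix {x : X} {p₁ p₂ a b : ℝ≥0} {ν₁ ν₂ : (Label A × X) →₀ ℝ≥0}
    (hab : a + b = 1) (h₁ : IsCombinedStep α x p₁ ν₁) (h₂ : IsCombinedStep α x p₂ ν₂) :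
    IsCombinedStep α x (a * p₁ + b * p₂) (a • ν₁ + b • ν₂) := by
  obtain ⟨k, p, θ, hp, hθ, rfl⟩ := h₁
  obtain ⟨l, q, ξ, hq, hξ, rfl⟩ := h₂
  refine ⟨k + l, Fin.append (fun i => a * p i) (fun i => b * q i), Fin.append θ ξ, ?_, ?_, ?_⟩
  · simp only [Fin.sum_univ_add, Fin.append_left, Fin.append_right, ← Finset.mul_sum]
    calc _ = a * (p₁ + ∑ i, p i) + b * (p₂ + ∑ i, q i) := by ring
      _ = 1 := by rw [hp, hq, mul_one, mul_one, hab]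
  · intro i
    refine Fin.addCases (fun i => ?_) (fun i => ?_) i
    · rw [Fin.append_left]; exact hθ i
    · rw [Fin.append_right]; exact hξ i
  · simp only [Fin.sum_univ_add, Fin.append_left, Fin.append_right, Finset.smul_sum, smul_smul]

theorem IsStep.isCombinedStep {x : X} {ν : (Label A × X) →₀ ℝ≥0} (h : IsStep α x ν) :
    IsCombinedStep α x 0 ν :=
  ⟨1, fun _ => 1, fun _ => ν, by simp, fun _ => h, by simp⟩

theorem WeakArrowN.succ {n : ℕ} {σ : Label A} {x : X} {μ : FinDist X}
    (h : WeakArrowN α n σ x μ) : WeakArrowN α (n + 1) σ x μ := by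
  induction n generalizing σ x μ with
  | zero =>
    obtain ⟨rfl, rfl⟩ := h
    -- Depth zero becomes depth one by deadlocking with probability 1, which is allowed since the
    -- letter is `tau`.
    exact ⟨1, 0, fun _ => FinDist.dirac x, ⟨0, fun _ => 0, fun _ => 0, by simp, by simp, by simp⟩,
      fun _ => rfl, by simp, by simp, by simp [FinDist.dirac]⟩
  | succ n ih =>
    obtain ⟨p₀, ν, κ, h1, h2, h3, h4, h5⟩ := h
    exact ⟨p₀, ν, κ, h1, h2, h3,
      fun q hq => ⟨fun e => ih ((h4 q hq).1 e), fun e => ih ((h4 q hq).2 e)⟩, h5⟩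

theorem WeakArrowN.mono {m n : ℕ} (hmn : m ≤ n) {σ : Label A} {x : X} {μ : FinDist X}
    (h : WeakArrowN α m σ x μ) : WeakArrowN α n σ x μ := by
  induction hmn with
  | refl => exact h
  | step _ ih => exact ih.succ

theorem WeakArrowN.mix {n : ℕ} {σ : Label A} {x : X} {μ₁ μ₂ μ : FinDist X} {a b : ℝ≥0}
    (hab : a + b = 1) (h₁ : WeakArrowN α n σ x μ₁) (h₂ : WeakArrowN α n σ x μ₂)
    (hμ : μ.wt = a • μ₁.wt + b • μ₂.wt) : WeakArrowN α n σ x μ := by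
  induction n generalizing σ x μ₁ μ₂ μ a b with
  | zero =>
    obtain ⟨rfl, rfl⟩ := h₁
    obtain ⟨-, rfl⟩ := h₂
    refine ⟨rfl, FinDist.ext ?_⟩
    rw [hμ, ← add_smul, hab, one_smul]
  | succ n ih =>
    obtain ⟨p₁, ν₁, κ₁, hs₁, hp₁, hl₁, hκ₁, e₁⟩ := h₁
    obtain ⟨p₂, ν₂, κ₂, hs₂, hp₂, hl₂, hκ₂, e₂⟩ := h₂
    obtain ⟨κ, hκ, eκ⟩ := exists_mix_family
      (P := fun (q : Label A × X) μ => (q.1 = σ → WeakArrowN α n tau q.2 μ) ∧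
        (q.1 ≠ σ → WeakArrowN α n σ q.2 μ))
      (fun q μ₁ μ₂ μ a b hab h₁ h₂ hμ =>
        ⟨fun e => ih hab (h₁.1 e) (h₂.1 e) hμ, fun e => ih hab (h₁.2 e) (h₂.2 e) hμ⟩) a b hκ₁ hκ₂
    refine ⟨a * p₁ + b * p₂, a • ν₁ + b • ν₂, κ, hs₁.mix hab hs₂, fun h => ?_, fun q h h' => ?_,
      hκ, ?_⟩
    -- For visible `σ` both deadlock probabilities vanish, hence so does their mixture.
    · by_contra hσ
      exact h (by rw [not_imp_comm.mp hp₁ hσ, not_imp_comm.mp hp₂ hσ]; simp)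
    · simp [hl₁ q h h', hl₂ q h h']
    · simp only [Finsupp.linearCombination_apply] at eκ
      rw [eκ, hμ, e₁, e₂, add_smul, mul_smul, mul_smul, smul_add, smul_add]
      exact add_add_add_comm _ _ _ _

theorem WeakArrow.mix {σ : Label A} {x : X} {μ₁ μ₂ μ : FinDist X} {a b : ℝ≥0}
    (hab : a + b = 1) (h₁ : WeakArrow α σ x μ₁) (h₂ : WeakArrow α σ x μ₂)
    (hμ : μ.wt = a • μ₁.wt + b • μ₂.wt) : WeakArrow α σ x μ := by
  obtain ⟨m, h₁⟩ := h₁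
  obtain ⟨n, h₂⟩ := h₂
  exact ⟨max m n, (h₁.mono (le_max_left _ _)).mix hab (h₂.mono (le_max_right _ _)) hμ⟩

/-- `μ` completes the step to the letter-state pair `q` to a weak `σ`-arrow. -/
def Completes (α : SimpleSegala A X) (σ : Label A) (q : Label A × X) (μ : FinDist X) : Prop :=
  (q.1 = σ ∧ WeakArrow α tau q.2 μ) ∨ (q.1 = tau ∧ WeakArrow α σ q.2 μ)

/-- Stated for all large depths, so that a maximum over a finite support gives one depth for a whole
step. -/
theorem Completes.exists_nat {σ : Label A} {q : Label A × X} {μ : FinDist X}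
    (h : Completes α σ q μ) : ∃ n, ∀ m, n ≤ m →
      (q.1 = σ → WeakArrowN α m tau q.2 μ) ∧ (q.1 ≠ σ → WeakArrowN α m σ q.2 μ) := by
  rcases h with ⟨h, n, hn⟩ | ⟨h, n, hn⟩
  · exact ⟨n, fun m hm => ⟨fun _ => hn.mono hm, fun h' => (h' h).elim⟩⟩
  -- If the silent letter equals `σ`, both clauses ask for the same `tau`-arrow.
  · exact ⟨n, fun m hm => ⟨fun e => by rw [← h, e]; exact hn.mono hm, fun _ => hn.mono hm⟩⟩

theorem IsStep.weakArrow {x : X} {ν : (Label A × X) →₀ ℝ≥0} (hν : IsStep α x ν) {σ : Label A}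
    {κ : Label A × X → FinDist X} (hκ : ∀ q ∈ ν.support, Completes α σ q (κ q))
    {μ : FinDist X} (hμ : μ.wt = linearCombination ℝ≥0 (fun q => (κ q).wt) ν) :
    WeakArrow α σ x μ := by
  choose! N hN using fun q hq => (hκ q hq).exists_nat
  refine ⟨ν.support.sup N + 1, 0, ν, κ, hν.isCombinedStep, by simp, fun q h h' => ?_,
    fun q hq => hN q hq _ (Finset.le_sup hq), by simp [hμ, Finsupp.linearCombination_apply]⟩
  by_contra hq
  rcases hκ q (Finsupp.mem_support_iff.mpr hq) with e | e
  exacts [h e.1, h' e.1]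

end WeakArrow

/-! ### Kleisli composition, explicitly -/

section Kleisli

variable {A : Type*}

/-- The letter performed by two consecutive letters, at least one of which is silent. -/
def join : Label A → Label A → Label A
  | none, ρ => ρ
  | some a, _ => some a

/-- The measure underlying `mult`. -/
def multMeasure {Z : Type*} : Label A → Label A × Z → ((Label A × Z) →₀ ℝ≥0)
  | σ, (none, x) => Finsupp.single (σ, x) 1
  | none, (some a, x) => Finsupp.single (some a, x) 1
  | some _, (some _, _) => 0

theorem mult_eq {Z : Type*} (p : Label A × (Label A × Z)) :
    mult p = CM.pure (multMeasure p.1 p.2) := by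
  obtain ⟨_ | a, _ | b, z⟩ := p <;> rfl

@[simp]
theorem multMeasure_none {Z : Type*} (r : Label A × Z) :
    multMeasure none r = Finsupp.single r 1 := by
  obtain ⟨_ | b, z⟩ := r <;> rfl

@[simp]
theorem multMeasure_tau {Z : Type*} (σ : Label A) (z : Z) :
    multMeasure σ (none, z) = Finsupp.single (σ, z) 1 := by
  cases σ <;> rfl

theorem mass_multMeasure_le {Z : Type*} (σ : Label A) (r : Label A × Z) :
    mass (multMeasure σ r) ≤ 1 := by
  obtain ⟨_ | b, z⟩ := r <;> cases σ <;> simp [multMeasure]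

/-- The mass detects a clash: it is 0 exactly when two visible letters meet. -/
theorem of_mass_multMeasure {Z : Type*} {σ : Label A} {r : Label A × Z}
    (h : mass (multMeasure σ r) = 1) :
    (σ = tau ∨ r.1 = tau) ∧ multMeasure σ r = Finsupp.single (join σ r.1, r.2) 1 := by
  obtain ⟨_ | b, z⟩ := r <;> cases σ <;> simp_all [multMeasure, join]

/-- The measure `ψ` after a letter `σ`. -/
def absorb {Z : Type*} (σ : Label A) :
    ((Label A × Z) →₀ ℝ≥0) →ₗ[ℝ≥0] ((Label A × Z) →₀ ℝ≥0) :=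
  linearCombination ℝ≥0 (multMeasure σ)

theorem absorb_tau {Z : Type*} (ψ : (Label A × Z) →₀ ℝ≥0) : absorb tau ψ = ψ := by
  simp [absorb, Finsupp.linearCombination_apply]

theorem absorb_tag_tau {Z : Type*} (σ : Label A) (φ : Z →₀ ℝ≥0) :
    absorb σ (tag tau φ) = tag σ φ := by
  simp only [absorb, tag, Finsupp.linearCombination_mapDomain]
  simp [Finsupp.linearCombination_apply, Finsupp.mapDomain, Function.comp_def]

/-- `mult` is singleton-valued, so the outer choice in the double composite is forced and only `φ`
and `ψ` remain. The choice `ψ` may depend on the letter as well as on the state. -/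
theorem mem_kcomp {X Y Z : Type*} {g : Y → CM (Label A × Z)} {f : X → CM (Label A × Y)} {x : X}
    {χ : (Label A × Z) →₀ ℝ≥0} :
    χ ∈ kcomp g f x ↔ ∃ φ ∈ f x, ∃ ψ : Label A × Y → ((Label A × Z) →₀ ℝ≥0),
      (∀ q, ψ q ∈ g q.2) ∧ χ = linearCombination ℝ≥0 (fun q => absorb q.1 (ψ q)) φ := by
  have key (φ : (Label A × Y) →₀ ℝ≥0) (ψ : Label A × Y → ((Label A × Z) →₀ ℝ≥0)) :
      linearCombination ℝ≥0 (fun p => multMeasure p.1 p.2)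
        (linearCombination ℝ≥0 (fun q => (ψ q).mapDomain fun y => (q.1, y)) φ) =
      linearCombination ℝ≥0 (fun q => absorb q.1 (ψ q)) φ := by
    rw [map_linearCombination]
    congr 1
    congr 1
    funext q
    rw [Finsupp.linearCombination_mapDomain]
    rfl
  constructor
  · rintro ⟨_, ⟨φ, hφ, ψ', hψ', rfl⟩, m, hm, rfl⟩
    have hm' : m = fun p => multMeasure p.1 p.2 := by
      funext p
      have := hm p
      rw [mult_eq] at this
      exact this
    choose ψ hψ hψe using hψ'
    refine ⟨φ, hφ, ψ, hψ, ?_⟩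
    rw [← key, hm']
    simp only [Finsupp.linearCombination_apply, hψe]
  · rintro ⟨φ, hφ, ψ, hψ, rfl⟩
    refine ⟨_, ⟨φ, hφ, fun q => (ψ q).mapDomain fun y => (q.1, y), fun q => ⟨_, hψ q, rfl⟩, rfl⟩,
      fun p => multMeasure p.1 p.2, fun p => ?_, ?_⟩
    · rw [mult_eq]
      rfl
    · rw [← key]
      simp only [Finsupp.linearCombination_apply]

end Kleisli

/-! ### Weak arrows and saturation -/

section Saturation

variable {A X : Type*} {α : SimpleSegala A X}

theorem IsStep.mem_toCoalg {x : X} {ν : (Label A × X) →₀ ℝ≥0} (h : IsStep α x ν) :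
    ν ∈ α.toCoalg x :=
  subset_convexHull _ _ (Or.inr h)

theorem WeakArrowN.tag_mem {β : X → CM (Label A × X)} (hβ : β ∈ saturatedAbove α.toCoalg)
    {n : ℕ} {σ : Label A} {x : X} {μ : FinDist X} (h : WeakArrowN α n σ x μ) :
    tag σ μ.wt ∈ β x := by
  induction n generalizing σ x μ with
  | zero =>
    obtain ⟨rfl, rfl⟩ := h
    refine hβ.1 x ?_
    simp only [tag, FinDist.dirac, Finsupp.mapDomain_single]
    rfl
  | succ n ih =>
    obtain ⟨p₀, ν, κ, ⟨k, p, θ, hp, hθ, hν⟩, hp₀, hl, hκ, hμ⟩ := h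
    have hx : p₀ ≠ 0 → tag σ (Finsupp.single x 1) ∈ β x := by
      intro h0
      rw [hp₀ h0]
      refine hβ.1 x ?_
      simp only [tag, Finsupp.mapDomain_single]
      rfl
    set s := ∑ i, p i with hs
    -- With no moving mass there is nothing to renormalise; the arrow is the pure deadlock.
    by_cases hs0 : s = 0
    · have hp1 : p₀ = 1 := by simpa [hs0] using hp
      have hν0 : ν = 0 := by
        rw [hν]
        refine Finset.sum_eq_zero fun i hi => ?_
        rw [Finset.sum_eq_zero_iff.mp hs0 i hi, zero_smul]
      simpa [hμ, hν0, hp1] using hx (by simp [hp1])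
    have hmem : s⁻¹ • ν ∈ β x := by
      rw [hν]
      exact convex_inv_smul_sum_mem (β x).convex (fun i _ => hβ.2.1 x (hθ i).mem_toCoalg) hs0
    have hψ : ∀ q : Label A × X, ∃ ψ ∈ β q.2, q ∈ ν.support →
        absorb q.1 ψ = tag σ (κ q).wt := by
      intro q
      by_cases hq : q ∈ ν.support
      · by_cases e : q.1 = σ
        · exact ⟨_, ih ((hκ q hq).1 e), fun _ => by rw [absorb_tag_tau, e]⟩
        · have e' : q.1 = tau := by
            by_contra e'
            exact (Finsupp.mem_support_iff.mp hq) (hl q e e')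
          exact ⟨_, ih ((hκ q hq).2 e), fun _ => by rw [e', absorb_tau]⟩
      · exact ⟨_, (β q.2).nonempty.some_mem, fun h => (hq h).elim⟩
    choose ψ hψ hψe using hψ
    have hc : s⁻¹ • tag σ (ν.sum fun q r => r • (κ q).wt) ∈ β x := by
      refine hβ.2.2 x (mem_kcomp.mpr ⟨_, hmem, ψ, hψ, ?_⟩)
      rw [map_smul, linearCombination_congr hψe]
      congr 1
      exact map_linearCombination (Finsupp.lmapDomain ℝ≥0 ℝ≥0 fun x => (σ, x)) _ ν
    have e : tag σ μ.wt = p₀ • tag σ (Finsupp.single x 1) +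
        s • s⁻¹ • tag σ (ν.sum fun q r => r • (κ q).wt) := by
      rw [smul_smul, mul_inv_cancel₀ hs0, one_smul, hμ]
      simp only [tag, Finsupp.mapDomain_add, Finsupp.mapDomain_smul]
    rw [e]
    -- For `p₀ = 0` the letter may be visible, and the tagged point mass at `x` need not lie in `β
    -- x`; convexity is used only when `p₀ ≠ 0`.
    by_cases h0 : p₀ = 0
    · have hs1 : s = 1 := by simpa [h0] using hp
      rw [h0, zero_smul, zero_add, hs1, one_smul, ← hs1]
      exact hc
    · exact (β x).convex (hx h0) hc zero_le zero_le hp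

theorem WeakArrow.tag_mem {σ : Label A} {x : X} {μ : FinDist X} (h : WeakArrow α σ x μ) :
    tag σ μ.wt ∈ saturation α.toCoalg x :=
  h.choose_spec.tag_mem (saturation_isLeast _).1

/-- The measures of mass at most one all of whose completions to probability measures are
weak arrows. -/
def weakCoalg (α : SimpleSegala A X) (x : X) : CM (Label A × X) where
  carrier := {φ | mass φ ≤ 1 ∧ ∀ (σ : Label A) (κ : Label A × X → FinDist X) (μ : FinDist X),
    (∀ q ∈ φ.support, Completes α σ q (κ q)) →
    μ.wt = linearCombination ℝ≥0 (fun q => (κ q).wt) φ → WeakArrow α σ x μ}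
  nonempty := by
    refine ⟨0, by simp, fun σ κ μ _ h => ?_⟩
    have := μ.mass_wt
    simp [h] at this
  convex := by
    rintro φ₁ ⟨hm₁, h₁⟩ φ₂ ⟨hm₂, h₂⟩ a b - - hab
    have hle : a * mass φ₁ + b * mass φ₂ ≤ 1 := by
      calc _ ≤ a * 1 + b * 1 := by gcongr
        _ = 1 := by rw [mul_one, mul_one, hab]
    refine ⟨by simpa using hle, fun σ κ μ hκ hμ => ?_⟩
    -- Zero weights are separated because the support of the mixture, where `κ` is controlled,
    -- contains the supports of both parts only for positive weights.
    by_cases ha : a = 0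
    · have hb : b = 1 := by simpa [ha] using hab
      subst ha hb
      simp only [zero_smul, one_smul, zero_add] at hκ hμ
      exact h₂ σ κ μ hκ hμ
    by_cases hb : b = 0
    · have ha : a = 1 := by simpa [hb] using hab
      subst ha hb
      simp only [zero_smul, one_smul, add_zero] at hκ hμ
      exact h₁ σ κ μ hκ hμ
    -- The completion has mass one, hence so has the mixture; positive weights then force mass one
    -- on both parts, so each can be completed by the same `κ`.
    have hmass : a * mass φ₁ + b * mass φ₂ = 1 := by
      have := μ.mass_wt
      rw [hμ, mass_linearCombination fun q _ => (κ q).mass_wt] at this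
      simpa using this
    have hm₁' : mass φ₁ = 1 := by
      by_contra h
      have : a * mass φ₁ < a * 1 := by
        gcongr
        exact lt_of_le_of_ne hm₁ h
      have : a * mass φ₁ + b * mass φ₂ < a * 1 + b * 1 :=
        add_lt_add_of_lt_of_le this (by gcongr)
      simp [hmass, hab] at this
    have hm₂' : mass φ₂ = 1 := by
      rw [hm₁', mul_one, ← hab] at hmass
      exact mul_left_cancel₀ hb (by rw [add_left_cancel hmass, mul_one])
    obtain ⟨μ₁, e₁⟩ := exists_finDist
      ((mass_linearCombination fun q _ => (κ q).mass_wt).trans hm₁')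
    obtain ⟨μ₂, e₂⟩ := exists_finDist
      ((mass_linearCombination fun q _ => (κ q).mass_wt).trans hm₂')
    refine WeakArrow.mix hab (h₁ σ κ μ₁ (fun q hq => hκ q ?_) e₁)
      (h₂ σ κ μ₂ (fun q hq => hκ q ?_) e₂) ?_
    · rw [Finsupp.mem_support_iff] at hq ⊢
      simp [ha, hq]
    · rw [Finsupp.mem_support_iff] at hq ⊢
      simp [hb, hq]
    · rw [hμ, map_add, map_smul, map_smul, e₁, e₂]

theorem kcomp_weakCoalg_le (α : SimpleSegala A X) :
    kcomp (weakCoalg α) (weakCoalg α) ≤ weakCoalg α := by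
  intro x χ hχ
  obtain ⟨φ, ⟨hφm, hφ⟩, ψ, hψ, rfl⟩ := mem_kcomp.mp hχ
  have hle : ∀ q : Label A × X, mass (absorb q.1 (ψ q)) ≤ 1 := fun q => by
    rw [absorb, map_linearCombination]
    exact linearCombination_le_one (mass_multMeasure_le _) (hψ q).1
  refine ⟨?_, fun σ κ μ hκ hμ => ?_⟩
  · rw [map_linearCombination]
    exact linearCombination_le_one hle hφm
  have hmass := μ.mass_wt
  rw [hμ, mass_linearCombination fun q _ => (κ q).mass_wt, map_linearCombination] at hmass
  obtain ⟨-, hq1⟩ := eq_one_of_linearCombination_eq_one hle hφm hmass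
  -- Two-stage completion: `K` completes the second factor `ψ q` after the letter of `q`; the test
  -- for `φ` is then applied to the family of these `K`.
  have hK : ∀ q : Label A × X, ∃ K : FinDist X, q ∈ φ.support → Completes α σ q K ∧
      K.wt = linearCombination ℝ≥0 (fun q => (κ q).wt) (absorb q.1 (ψ q)) := by
    intro q
    by_cases hq : q ∈ φ.support
    swap
    · exact ⟨κ q, fun h => (hq h).elim⟩
    have hq1 := hq1 q hq
    obtain ⟨K, eK⟩ := exists_finDist
      ((mass_linearCombination fun q _ => (κ q).mass_wt).trans hq1)
    rw [absorb, map_linearCombination] at hq1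
    obtain ⟨hψ1, hr1⟩ :=
      eq_one_of_linearCombination_eq_one (mass_multMeasure_le _) (hψ q).1 hq1
    have hκr : ∀ r ∈ (ψ q).support, Completes α σ (join q.1 r.1, r.2) (κ (join q.1 r.1, r.2)) := by
      intro r hr
      refine hκ _ (mem_support_linearCombination hq (mem_support_linearCombination hr ?_))
      rw [(of_mass_multMeasure (hr1 r hr)).2]
      simp
    have eK' : K.wt =
        linearCombination ℝ≥0 (fun r => (κ (join q.1 r.1, r.2)).wt) (ψ q) := by
      rw [eK, absorb, map_linearCombination]
      refine linearCombination_congr fun r hr => ?_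
      rw [(of_mass_multMeasure (hr1 r hr)).2]
      simp
    refine ⟨K, fun _ => ⟨?_, eK⟩⟩
    obtain ⟨_ | a, y⟩ := q
    · exact Or.inr ⟨rfl, (hψ _).2 σ _ K hκr eK'⟩
    -- After a visible letter no mass is lost only if `ψ` carries silent letters alone. What remains
    -- is a `tau`-arrow, so `ψ` is tested at `tau` instead of `σ`.
    · have hτ : ∀ r ∈ (ψ (some a, y)).support, r.1 = tau := fun r hr =>
        ((of_mass_multMeasure (hr1 r hr)).1).resolve_left (by simp)
      have hσ : ∀ r ∈ (ψ (some a, y)).support, some a = σ ∧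
          WeakArrow α tau r.2 (κ (some a, r.2)) := fun r hr => by
        rcases hκr r hr with h | h
        · exact h
        · exact absurd h.1 (by simp [join])
      -- The equality of the visible letter with `σ` is read off at any point of the support, so one
      -- is needed.
      obtain ⟨r, hr⟩ : (ψ (some a, y)).support.Nonempty := by
        rw [Finsupp.support_nonempty_iff]
        intro h
        simp [h] at hψ1
      exact Or.inl ⟨(hσ r hr).1, (hψ _).2 tau _ K
        (fun r hr => Or.inl ⟨hτ r hr, (hσ r hr).2⟩) eK'⟩
  choose K hK using hK
  refine hφ σ K μ (fun q hq => (hK q hq).1) ?_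
  rw [hμ, map_linearCombination]
  exact linearCombination_congr fun q hq => (hK q hq).2.symm

theorem weakCoalg_mem_saturatedAbove (α : SimpleSegala A X) :
    weakCoalg α ∈ saturatedAbove α.toCoalg := by
  refine ⟨?_, ?_, kcomp_weakCoalg_le α⟩
  · rintro x φ rfl
    refine ⟨by simp, fun σ κ μ hκ hμ => ?_⟩
    have : μ = κ (tau, x) := FinDist.ext (by simpa using hμ)
    rw [this]
    rcases hκ (tau, x) (by simp) with h | h
    · rw [← h.1]
      exact h.2
    · exact h.2
  · intro x
    refine convexHull_min ?_ (weakCoalg α x).convex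
    rintro ν (rfl | hν)
    · refine ⟨by simp, fun σ κ μ _ h => ?_⟩
      have := μ.mass_wt
      simp [h] at this
    · refine ⟨?_, fun σ κ μ hκ hμ => IsStep.weakArrow hν hκ hμ⟩
      obtain ⟨σ, μ, -, rfl⟩ := hν
      simp [tag]

theorem label_eq_of_mem_support_tag {σ : Label A} {φ : X →₀ ℝ≥0} {q : Label A × X}
    (hq : q ∈ (tag σ φ).support) : q.1 = σ := by
  classical
  obtain ⟨x, -, rfl⟩ := Finset.mem_image.mp (Finsupp.mapDomain_support hq)
  rfl

/-- Apply the test defining `weakCoalg` to the trivial completion: after `σ`, stay put by the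
`tau`-arrow of depth zero. -/
theorem weakArrow_of_tag_mem {σ : Label A} {x : X} {μ : FinDist X}
    (h : tag σ μ.wt ∈ saturation α.toCoalg x) : WeakArrow α σ x μ := by
  refine ((saturation_isLeast _).2 (weakCoalg_mem_saturatedAbove α) x h).2 σ
    (fun q => FinDist.dirac q.2) μ
    (fun q hq => Or.inl ⟨label_eq_of_mem_support_tag hq, 0, rfl, rfl⟩) ?_
  rw [tag, Finsupp.linearCombination_mapDomain]
  simp [Finsupp.linearCombination_apply, FinDist.dirac, Function.comp_def]

/-- A measure some image of which is supported on the letter `σ` is itself tagged by `σ`. -/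
theorem eq_tag_of_mapDomain_eq_tag {Y : Type*} {f : X → Y} {σ : Label A}
    {ρ : (Label A × X) →₀ ℝ≥0} {φ : Y →₀ ℝ≥0} (h : ρ.mapDomain (Prod.map id f) = tag σ φ) :
    ρ = tag σ (ρ.mapDomain Prod.snd) := by
  rw [tag, ← Finsupp.mapDomain_comp]
  conv_lhs => rw [← Finsupp.mapDomain_id (v := ρ)]
  refine Finsupp.mapDomain_congr fun q hq => Prod.ext ?_ rfl
  have := mem_support_mapDomain (f := Prod.map id f) hq
  rw [h] at this
  have hq' : (Prod.map id f q).1 = σ := label_eq_of_mem_support_tag this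
  exact hq'

theorem mapDomain_tag {Y : Type*} (f : X → Y) (σ : Label A) (φ : X →₀ ℝ≥0) :
    (tag σ φ).mapDomain (Prod.map id f) = tag σ (φ.mapDomain f) := by
  rw [tag, tag, ← Finsupp.mapDomain_comp, ← Finsupp.mapDomain_comp]
  rfl

theorem mapDomain_snd_tag (σ : Label A) (φ : X →₀ ℝ≥0) :
    (tag σ φ).mapDomain Prod.snd = φ := by
  rw [tag, ← Finsupp.mapDomain_comp]
  exact Finsupp.mapDomain_id

/-! ### The two notions of weak bisimulation -/

theorem IsProbWeakBisim.isCoalgWeakBisim {R : X → X → Prop} (h : IsProbWeakBisim α R) :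
    IsCoalgWeakBisim α.toCoalg R := by
  have hzero : ∀ x, (0 : (Label A × X) →₀ ℝ≥0) ∈ saturation α.toCoalg x := fun x =>
    (saturation_isLeast _).1.2.1 x (subset_convexHull _ _ (Or.inl rfl))
  -- The largest structure satisfying the condition on second projections, which becomes immediate.
  -- As its values are convex, the first condition need only be checked on 0 and on steps.
  let γ : Graph R → CM (Label A × Graph R) := fun p =>
    { carrier := Finsupp.lmapDomain ℝ≥0 ℝ≥0 (Prod.map id snd) ⁻¹'
        (saturation α.toCoalg (snd p)).carrier
      nonempty := ⟨0, by
        rw [Set.mem_preimage, map_zero]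
        exact hzero _⟩
      convex := (saturation α.toCoalg (snd p)).convex.linear_preimage _ }
  refine ⟨fun x y hxy => h.1.symm hxy, γ, fun p => ?_, ?_⟩
  · refine convexHull_min ?_ (tmap fst (γ p)).convex
    rintro ν (rfl | ⟨σ, μ, hμ, rfl⟩)
    · refine ⟨0, ?_, Finsupp.mapDomain_zero⟩
      change Finsupp.lmapDomain ℝ≥0 ℝ≥0 _ 0 ∈ (saturation α.toCoalg (snd p)).carrier
      rw [map_zero]
      exact hzero _
    · obtain ⟨μ', hw, ρ, rfl, rfl⟩ := h.2 _ _ p.2 σ μ hμ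
      refine ⟨tag σ ρ.wt, ?_, mapDomain_tag _ _ _⟩
      change (tag σ ρ.wt).mapDomain _ ∈ saturation α.toCoalg (snd p)
      rw [mapDomain_tag]
      exact hw.tag_mem
  · rintro p _ ⟨ρ, hρ, rfl⟩
    exact hρ

theorem IsCoalgWeakBisim.isProbWeakBisim {R : X → X → Prop} (hR : Equivalence R)
    (h : IsCoalgWeakBisim α.toCoalg R) : IsProbWeakBisim α R := by
  obtain ⟨-, γ, h₁, h₂⟩ := h
  refine ⟨hR, fun x y hxy σ μ hμ => ?_⟩
  obtain ⟨ρ, hρ, e⟩ := h₁ ⟨(x, y), hxy⟩ (IsStep.mem_toCoalg ⟨σ, μ, hμ, rfl⟩)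
  have hτ := eq_tag_of_mapDomain_eq_tag e
  obtain ⟨ρ', hρ'⟩ : ∃ ρ' : FinDist (Graph R), ρ'.wt = ρ.mapDomain Prod.snd := by
    -- Push-forwards preserve mass, so the measure on `R` inherits mass one from `μ`.
    refine exists_finDist ?_
    have := congrArg mass e
    simpa [tag] using this
  rw [← hρ'] at hτ
  refine ⟨ρ'.map snd, weakArrow_of_tag_mem ?_, ρ', FinDist.ext ?_, rfl⟩
  · have := h₂ ⟨(x, y), hxy⟩ ⟨ρ, hρ, rfl⟩
    rw [hτ, mapDomain_tag] at this
    exact this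
  · rw [hτ, mapDomain_tag] at e
    have := congrArg (Finsupp.mapDomain Prod.snd) e
    rwa [mapDomain_snd_tag, mapDomain_snd_tag] at this

end Saturation

end SegalaWeak

end

theorem mainTheorem1 {A : Type*} {X : Type*} (α : SegalaWeak.SimpleSegala A X)
    (R : X → X → Prop) (hR : Equivalence R) :
    SegalaWeak.IsProbWeakBisim α R ↔ SegalaWeak.IsCoalgWeakBisim α.toCoalg R :=
  ⟨fun h => h.isCoalgWeakBisim, fun h => h.isProbWeakBisim hR⟩
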